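/- Let $k$ be a field, $n \ge 0$ an integer, and $R = k[x_1,\dots,x_n]$ with its standard grading. For $J \subseteq [n] = \{1,\dots,n\}$ let $\mathfrak{m}_J = (x_j : j \in J)$, with $\mathfrak{m}_\emptyset = (0)$. Then for all $J, K \subseteq [n]$ and all positive integers $a, b$, the ideal $I = \mathfrak{m}_J^a \cap \mathfrak{m}_K^b$ of $R$ is componentwise linear. Here a homogeneous ideal $I$ is called componentwise linear if, for every integer $d \ge 0$, the ideal $(I_d)$ generated by all forms of degree $d$ in $I$ has a linear resolution, i.e. in its minimal graded free resolution $$0 \to \bigoplus_j R(-j)^{\beta_{h,j}} \to \cdots \to \bigoplus_j R(-j)^{\beta_{0,j}} \to (I_d) \to 0$$ one has $\beta_{i,j} = 0$ for all $i \ge 0$ and all $j \ne i + d$. (If $(I_d) = 0$, its minimal resolution is zero and the condition holds.) -/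

import Mathlib

namespace CWL

open MvPolynomial

/-- Let `F = ⨁ₑ R(-deg e)` be the graded free module over `R = k[σ]` with one basis element of
degree `deg e` for every `e : B`. The vector `v` of `F` is homogeneous of degree `j` if each
monomial `m` that occurs in the coordinate `v e` satisfies `deg m + deg e = j`
(the zero vector is homogeneous of every degree). -/
def IsHomogeneousVec {σ k B : Type*} [CommSemiring k] (deg : B → ℕ)
    (v : B →₀ MvPolynomial σ k) (j : ℕ) : Prop :=
  ∀ (e : B) (m : σ →₀ ℕ), coeff m (v e) ≠ 0 → m.degree + deg e = j

/-- A minimal graded free resolution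
`0 → F_h → ⋯ → F_1 → F_0 → I → 0` of an ideal `I` of `R = k[σ]`, where
`F_i = ⨁ₑ R(-deg i e)` is the graded free module of finite rank on the basis `gen i`. -/
structure MinimalGradedFreeResolution {σ k : Type*} [Field k]
    (I : Ideal (MvPolynomial σ k)) where
  /-- the basis of `F_i` -/
  gen : ℕ → Type
  /-- each `F_i` has finite rank -/
  finite_gen : ∀ i, Finite (gen i)
  /-- the degrees of the basis elements of `F_i` -/
  deg : ∀ i, gen i → ℕ
  /-- the differential `F_{i+1} → F_i` -/
  d : ∀ i, (gen (i + 1) →₀ MvPolynomial σ k) →ₗ[MvPolynomial σ k] (gen i →₀ MvPolynomial σ k)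
  /-- the augmentation `F_0 → I`, composed with the inclusion of `I` in `R` -/
  ε : (gen 0 →₀ MvPolynomial σ k) →ₗ[MvPolynomial σ k] MvPolynomial σ k
  /-- the differentials are homogeneous of degree `0` -/
  d_homogeneous : ∀ i e, IsHomogeneousVec (deg i) (d i (Finsupp.single e 1)) (deg (i + 1) e)
  /-- the augmentation is homogeneous of degree `0` -/
  ε_homogeneous : ∀ e, (ε (Finsupp.single e 1)).IsHomogeneous (deg 0 e)
  /-- exactness at `I` -/
  range_ε : LinearMap.range ε = I
  /-- exactness at `F_0` -/
  exact_zero : Function.Exact (d 0) ε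
  /-- exactness at `F_{i+1}` -/
  exact_succ : ∀ i, Function.Exact (d (i + 1)) (d i)
  /-- the resolution has finite length -/
  finite_length : ∃ h, ∀ i, h < i → IsEmpty (gen i)
  /-- minimality: the image of `F_{i+1}` lies in `𝔪 F_i`, where `𝔪` is the ideal generated by
  the variables, that is, the entries of the matrices of the differentials have no constant
  term -/
  minimal : ∀ i e f, constantCoeff (d i (Finsupp.single e 1) f) = 0

/-- The graded Betti number `β_{i,j}` read off from a minimal graded free resolution: the number
of copies of `R(-j)` in `F_i`. -/
noncomputable def MinimalGradedFreeResolution.betti {σ k : Type*} [Field k]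
    {I : Ideal (MvPolynomial σ k)} (F : MinimalGradedFreeResolution I) (i j : ℕ) : ℕ :=
  Nat.card {e : F.gen i // F.deg i e = j}

/-- `(I_d)`: the ideal generated by all forms of degree `d` in `I`. -/
noncomputable def component {σ k : Type*} [Field k] (I : Ideal (MvPolynomial σ k)) (d : ℕ) :
    Ideal (MvPolynomial σ k) :=
  Ideal.span {f | f ∈ I ∧ f.IsHomogeneous d}

/-- `I` is generated by forms of degree `d` and has a linear resolution: its minimal graded free
resolution (which is unique up to isomorphism) has `β_{i,j} = 0` whenever `j ≠ i + d`. The zero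
ideal, whose minimal resolution is zero, satisfies this for every `d`. -/
def HasLinearResolution {σ k : Type*} [Field k] (I : Ideal (MvPolynomial σ k)) (d : ℕ) : Prop :=
  component I d = I ∧
    ∃ F : MinimalGradedFreeResolution I, ∀ i j, j ≠ i + d → F.betti i j = 0

/-- `I` is homogeneous, and `(I_d)` has a linear resolution for all `d`. -/
def IsComponentwiseLinear {σ k : Type*} [Field k] (I : Ideal (MvPolynomial σ k)) : Prop :=
  letI : GradedAlgebra (homogeneousSubmodule σ k) := MvPolynomial.gradedAlgebra
  I.IsHomogeneous (homogeneousSubmodule σ k) ∧ ∀ d, HasLinearResolution (component I d) d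

/-- `𝔪_J`: the ideal generated by the variables `x_j` with `j ∈ J`. -/
noncomputable def veroneseIdeal {σ : Type*} (k : Type*) [Field k] (J : Set σ) : Ideal (MvPolynomial σ k) :=
  Ideal.span (X '' J)

end CWL

/-! The ideal is monomial: a monomial lies in it when its degree in the variables of `J` is at least
`a` and its degree in those of `K` is at least `b` (`mem_veroneseIdeal_pow`). So `(I_d)` is
generated by the monomials of degree `d` of this kind, and it suffices to show that they have linear
quotients.

List them by descending `orderKey`. If `u` precedes `v`, then `exists_exchange` yields a variable
`x_j` with `v j < u j` and a monomial `w` before `v` that divides `x_j v`. Hence the colon ideal of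
the earlier monomials by `v` is generated by variables (`exists_hasLinRes_of_exchange`), and such
ideals have linear resolutions (`exists_hasLinRes_span_X`). Adjoining `v` extends the syzygy module
by this colon ideal, so linearity survives by the horseshoe lemma (`HasLinRes.sup_span_singleton`).
A resolution whose matrices consist of linear forms is automatically minimal. -/

namespace CWL

open MvPolynomial Finsupp

/-! ### Linear resolutions, the horseshoe lemma and colon ideals. -/

section Graded

variable {σ k : Type*} [Field k]

theorem homogeneousComponent_mul_of_isHomogeneous {d : ℕ} {q : MvPolynomial σ k}
    (hq : q.IsHomogeneous d) (j : ℕ) (p : MvPolynomial σ k) :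
    homogeneousComponent (j + d) (p * q) = homogeneousComponent j p * q := by
  induction p using MvPolynomial.induction_on' with
  | monomial m c =>
    have h : (monomial m c).IsHomogeneous m.degree := isHomogeneous_monomial c rfl
    rw [homogeneousComponent_of_mem (h.mul hq), homogeneousComponent_of_mem h]
    by_cases hj : j = m.degree
    · simp [hj]
    · rw [if_neg hj, if_neg (by omega), zero_mul]
  | add p₁ p₂ h₁ h₂ => rw [add_mul, map_add, h₁, h₂, map_add, add_mul]

/-- The part of degree `j` of a vector. -/
noncomputable def vecComponent {G : Type*} (j : ℕ) :
    (G →₀ MvPolynomial σ k) →ₗ[k] (G →₀ MvPolynomial σ k) :=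
  Finsupp.mapRange.linearMap (homogeneousComponent j)

@[simp]
theorem vecComponent_apply {G : Type*} (j : ℕ) (x : G →₀ MvPolynomial σ k) (g : G) :
    vecComponent j x g = homogeneousComponent j (x g) := by
  simp [vecComponent]

theorem linearCombination_vecComponent {G G' : Type*} {d : ℕ} {v : G' → G →₀ MvPolynomial σ k}
    (hv : ∀ e g, (v e g).IsHomogeneous d) (j : ℕ) (x : G' →₀ MvPolynomial σ k) :
    linearCombination (MvPolynomial σ k) v (vecComponent j x) =
      vecComponent (j + d) (linearCombination (MvPolynomial σ k) v x) := by
  induction x using Finsupp.induction_linear with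
  | zero => simp
  | add x y hx hy => rw [map_add, map_add, hx, hy, map_add, map_add]
  | single e p =>
    have : vecComponent j (single e p) = single e (homogeneousComponent j p) := by
      simp [vecComponent]
    rw [this, linearCombination_single, linearCombination_single]
    ext1 g
    simp [homogeneousComponent_mul_of_isHomogeneous (hv e g)]

/-- A submodule of a free module that contains the components of its elements. -/
def IsGradedSubmodule {G : Type*} (N : Submodule (MvPolynomial σ k) (G →₀ MvPolynomial σ k)) :
    Prop :=
  ∀ x ∈ N, ∀ j, vecComponent j x ∈ N

/-- Syzygy modules are the graded submodules to which the horseshoe lemma is applied. -/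
theorem isGradedSubmodule_ker {G G' : Type*} {d : ℕ} {v : G' → G →₀ MvPolynomial σ k}
    (hv : ∀ e g, (v e g).IsHomogeneous d) :
    IsGradedSubmodule (LinearMap.ker (linearCombination (MvPolynomial σ k) v)) := by
  intro x hx j
  rw [LinearMap.mem_ker] at hx ⊢
  rw [linearCombination_vecComponent hv, hx, map_zero]

theorem linearCombination_sumElim {α β G : Type*} (v : α → G →₀ MvPolynomial σ k)
    (w : β → G →₀ MvPolynomial σ k) (x : α →₀ MvPolynomial σ k) (y : β →₀ MvPolynomial σ k) :
    linearCombination (MvPolynomial σ k) (Sum.elim v w) (x.sumElim y) =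
      linearCombination (MvPolynomial σ k) v x + linearCombination (MvPolynomial σ k) w y := by
  rw [sumElim_eq_add, map_add, linearCombination_mapDomain, linearCombination_mapDomain]
  rfl

theorem exists_eq_sumElim {α β M : Type*} [Zero M] (z : α ⊕ β →₀ M) :
    ∃ x y, z = Finsupp.sumElim x y :=
  ⟨_, _, (comapDomain_sumElim_comapDomain z).symm⟩

/-- The submodule `N` of a free module (with basis in degree `0`) is generated by vectors of
degree `d` and has a linear free resolution `0 → F_{h-1} → ⋯ → F_0 → N → 0`. -/
def HasLinRes : ℕ → {G : Type} → ℕ →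
    Submodule (MvPolynomial σ k) (G →₀ MvPolynomial σ k) → Prop
  | 0, _, _, N => N = ⊥
  | h + 1, G, d, N => ∃ (G' : Type) (_ : Finite G') (v : G' → G →₀ MvPolynomial σ k),
      (∀ e g, (v e g).IsHomogeneous d) ∧
      LinearMap.range (linearCombination (MvPolynomial σ k) v) = N ∧
      -- The new basis is again placed in degree `0`, so from here on linearity means that the
      -- matrix entries have degree `1`.
      HasLinRes h 1 (LinearMap.ker (linearCombination (MvPolynomial σ k) v))

/-- The length is only an upper bound: free modules on `Empty` pad the resolution. This lets two
resolutions be brought to a common length. -/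
theorem HasLinRes.succ {h : ℕ} : ∀ {G : Type} {d : ℕ}
    {N : Submodule (MvPolynomial σ k) (G →₀ MvPolynomial σ k)},
    HasLinRes h d N → HasLinRes (h + 1) d N := by
  induction h with
  | zero =>
    intro G d N hN
    refine ⟨Empty, inferInstance, Empty.elim, fun e => e.elim, ?_, ?_⟩
    · rw [range_linearCombination, (show N = ⊥ from hN)]
      simp
    · exact Subsingleton.elim _ _
  | succ h ih =>
    rintro G d N ⟨G', _, v, hv, hr, hk⟩
    exact ⟨G', inferInstance, v, hv, hr, ih hk⟩

theorem HasLinRes.mono {h h' : ℕ} (hh : h ≤ h') {G : Type} {d : ℕ}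
    {N : Submodule (MvPolynomial σ k) (G →₀ MvPolynomial σ k)} (hN : HasLinRes h d N) :
    HasLinRes h' d N := by
  induction hh with
  | refl => exact hN
  | step _ ih => exact ih.succ

/-- The horseshoe lemma for linear resolutions. -/
theorem HasLinRes.horseshoe {h : ℕ} : ∀ {α β : Type} {d : ℕ}
    {A : Submodule (MvPolynomial σ k) (α →₀ MvPolynomial σ k)}
    {B : Submodule (MvPolynomial σ k) (α ⊕ β →₀ MvPolynomial σ k)}
    {C : Submodule (MvPolynomial σ k) (β →₀ MvPolynomial σ k)},
    IsGradedSubmodule B → (∀ x, x ∈ A ↔ x.sumElim 0 ∈ B) → (∀ y, y ∈ C ↔ ∃ x, sumElim x y ∈ B) →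
    HasLinRes h d A → HasLinRes h d C → HasLinRes h d B := by
  induction h with
  | zero =>
    intro α β d A B C _ hA hC rA rC
    simp only [HasLinRes] at rA rC ⊢
    rw [Submodule.eq_bot_iff] at rA rC ⊢
    intro z hz
    obtain ⟨x, y, rfl⟩ := exists_eq_sumElim z
    obtain rfl := rC y ((hC y).2 ⟨x, hz⟩)
    obtain rfl := rA x ((hA x).2 hz)
    simp
  | succ h ih =>
    rintro α β d A B C gB hA hC ⟨GA, _, v, hv, rfl, kA⟩ ⟨GC, _, w, hw, rfl, kC⟩
    -- Any lift of `w e` to `B` may be replaced by its part of degree `d`, since `B` is graded and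
    -- `w e` is already homogeneous of degree `d`.
    have lift : ∀ e, ∃ u : α →₀ MvPolynomial σ k, (∀ g, (u g).IsHomogeneous d) ∧
        u.sumElim (w e) ∈ B := by
      intro e
      obtain ⟨x, hx⟩ := (hC (w e)).1 ⟨single e 1, by simp⟩
      refine ⟨vecComponent d x, fun g => ?_, ?_⟩
      · simpa using homogeneousComponent_isHomogeneous d (x g)
      · convert gB _ hx d using 1
        ext1 (g | g)
        · simp
        · simp only [sumElim_apply, Sum.elim_inr, vecComponent_apply]
          rw [homogeneousComponent_of_mem (hw e g), if_pos rfl]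
    choose u hu huB using lift
    set v' : GA → α ⊕ β →₀ MvPolynomial σ k := fun e => (v e).sumElim 0 with hv'
    set w' : GC → α ⊕ β →₀ MvPolynomial σ k := fun e => (u e).sumElim (w e) with hw'
    have lv : ∀ x, linearCombination (MvPolynomial σ k) v' x =
        (linearCombination (MvPolynomial σ k) v x).sumElim 0 := by
      intro x
      ext1 (g | g) <;> simp [linearCombination_apply, Finsupp.sum, hv']
    have lw : ∀ y, linearCombination (MvPolynomial σ k) w' y =
        (linearCombination (MvPolynomial σ k) u y).sumElim
          (linearCombination (MvPolynomial σ k) w y) := by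
      intro x
      ext1 (g | g) <;> simp [linearCombination_apply, Finsupp.sum, hw']
    have lvB : ∀ x, linearCombination (MvPolynomial σ k) v' x ∈ B := by
      intro x
      rw [lv, ← hA]
      exact ⟨x, rfl⟩
    have lwB : ∀ y, linearCombination (MvPolynomial σ k) w' y ∈ B := by
      intro y
      rw [linearCombination_apply]
      exact Submodule.sum_mem _ fun e _ => Submodule.smul_mem _ _ (huB e)
    have hvw : ∀ e g, (Sum.elim v' w' e g).IsHomogeneous d := by
      rintro (e | e) (g | g)
      · exact hv e g
      · exact isHomogeneous_zero _ _ _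
      · exact hu e g
      · exact hw e g
    -- a vector of `B` whose second part is that of a known vector comes from `A`
    have fill : ∀ (x : α →₀ MvPolynomial σ k) y, x.sumElim (linearCombination (MvPolynomial σ k) w y) ∈ B →
        ∃ a, x.sumElim (linearCombination (MvPolynomial σ k) w y) =
          linearCombination (MvPolynomial σ k) (Sum.elim v' w') (Finsupp.sumElim a y) := by
      intro x y hx
      have hB := B.sub_mem hx (lwB y)
      have e1 : x.sumElim (linearCombination (MvPolynomial σ k) w y) -
          linearCombination (MvPolynomial σ k) w' y =
          (x - linearCombination (MvPolynomial σ k) u y).sumElim 0 := by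
        rw [lw]
        ext1 (g | g) <;> simp
      rw [e1, ← hA] at hB
      obtain ⟨a, ha⟩ := hB
      refine ⟨a, ?_⟩
      rw [linearCombination_sumElim, lv, ha, ← e1, sub_add_cancel]
    refine ⟨GA ⊕ GC, inferInstance, Sum.elim v' w', hvw, ?_, ?_⟩
    · apply le_antisymm
      · rintro _ ⟨z, rfl⟩
        obtain ⟨x, y, rfl⟩ := exists_eq_sumElim z
        rw [linearCombination_sumElim]
        exact B.add_mem (lvB x) (lwB y)
      · intro z hz
        obtain ⟨x, y, rfl⟩ := exists_eq_sumElim z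
        obtain ⟨c, rfl⟩ := (hC y).2 ⟨x, hz⟩
        obtain ⟨a, ha⟩ := fill x c hz
        exact ⟨_, ha.symm⟩
    -- As in the snake lemma, the kernels of the three augmentations form a short exact sequence, to
    -- which the induction hypothesis applies; `fill` gives surjectivity on the right.
    · refine ih (isGradedSubmodule_ker hvw) (fun x => ?_) (fun y => ?_) kA kC
      · rw [LinearMap.mem_ker, LinearMap.mem_ker, linearCombination_sumElim, map_zero, add_zero, lv]
        constructor
        · intro hx
          simp [hx]
        · intro hx
          ext1 g
          simpa using DFunLike.congr_fun hx (Sum.inl g)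
      · simp only [LinearMap.mem_ker]
        constructor
        · intro hy
          obtain ⟨a, ha⟩ := fill 0 y (by simp [hy])
          exact ⟨a, by rw [← ha, hy, sumElim_zero_zero]⟩
        · rintro ⟨x, hx⟩
          rw [linearCombination_sumElim, lv, lw] at hx
          ext1 g
          simpa using DFunLike.congr_fun hx (Sum.inr g)

/-- An ideal as a submodule of the free module of rank one. -/
noncomputable def unitSubmodule (I : Ideal (MvPolynomial σ k)) :
    Submodule (MvPolynomial σ k) (Unit →₀ MvPolynomial σ k) :=
  Submodule.comap (Finsupp.lapply ()) I

@[simp]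
theorem mem_unitSubmodule {I : Ideal (MvPolynomial σ k)} {x : Unit →₀ MvPolynomial σ k} :
    x ∈ unitSubmodule I ↔ x () ∈ I :=
  Iff.rfl

/-- Adding a form `u` with linearly resolved colon ideal `P = I : u` to `I`. -/
theorem HasLinRes.sup_span_singleton {I P : Ideal (MvPolynomial σ k)} {d h h' : ℕ}
    {u : MvPolynomial σ k} (hu : u.IsHomogeneous d) (hP : ∀ r, r ∈ P ↔ r * u ∈ I)
    (rI : HasLinRes h d (unitSubmodule I)) (rP : HasLinRes h' 1 (unitSubmodule P)) :
    ∃ h'', HasLinRes h'' d (unitSubmodule (I ⊔ Ideal.span {u})) := by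
  -- The extra `succ` makes the length positive, so that generators can be extracted.
  obtain ⟨G, _, v, hv, hr, hk⟩ := (rI.mono (le_max_left h h')).succ
  have rP := rP.mono (le_max_right h h')
  set w : Unit → Unit →₀ MvPolynomial σ k := fun _ => single () u with hw
  have lw : ∀ y, linearCombination (MvPolynomial σ k) w y = single () (y () * u) := by
    intro y
    ext1
    simp [linearCombination_unique, hw]
  have hvw : ∀ e g, (Sum.elim v w e g).IsHomogeneous d := by
    rintro (e | e) g
    · exact hv e g
    · simpa [hw] using hu
  refine ⟨max h h' + 1, G ⊕ Unit, inferInstance, Sum.elim v w, hvw, ?_, ?_⟩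
  · ext x
    rw [mem_unitSubmodule, Submodule.mem_sup]
    constructor
    · rintro ⟨z, rfl⟩
      obtain ⟨x, y, rfl⟩ := exists_eq_sumElim z
      have hx : linearCombination (MvPolynomial σ k) v x ∈ unitSubmodule I := hr ▸ ⟨x, rfl⟩
      refine ⟨_, hx, y () * u, Ideal.mem_span_singleton'.2 ⟨_, rfl⟩, ?_⟩
      rw [linearCombination_sumElim, lw]
      simp
    · rintro ⟨p, hp, q, hq, hpq⟩
      obtain ⟨c, rfl⟩ := Ideal.mem_span_singleton'.1 hq
      have hx : single () p ∈ unitSubmodule I := by simpa using hp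
      rw [← hr] at hx
      obtain ⟨a, ha⟩ := hx
      refine ⟨a.sumElim (single () c), ?_⟩
      rw [linearCombination_sumElim, lw, ha]
      ext1
      simp [← hpq]
  -- The coefficient of `u` maps the syzygies of `(v, u)` onto `P = I : u`, with kernel the syzygies
  -- of `v`.
  · refine HasLinRes.horseshoe (isGradedSubmodule_ker hvw) (fun x => ?_) (fun y => ?_) hk rP
    · rw [LinearMap.mem_ker, LinearMap.mem_ker, linearCombination_sumElim, map_zero, add_zero]
    · simp only [LinearMap.mem_ker, linearCombination_sumElim, lw, mem_unitSubmodule, hP]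
      constructor
      · intro hy
        have hx : single () (-(y () * u)) ∈ unitSubmodule I := by simpa using hy
        rw [← hr] at hx
        obtain ⟨a, ha⟩ := hx
        exact ⟨a, by rw [ha, ← single_add, neg_add_cancel, single_zero]⟩
      · rintro ⟨x, hx⟩
        have hx' : linearCombination (MvPolynomial σ k) v x ∈ unitSubmodule I := hr ▸ ⟨x, rfl⟩
        rw [eq_neg_of_add_eq_zero_left hx] at hx'
        simpa using hx'

theorem hasLinRes_bot (d : ℕ) : HasLinRes 0 d (unitSubmodule (⊥ : Ideal (MvPolynomial σ k))) := by
  simp only [HasLinRes]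
  rw [Submodule.eq_bot_iff]
  intro x hx
  ext1
  simpa using hx

/-- Ideals generated by variables have linear resolutions. -/
theorem exists_hasLinRes_span_X (S : Finset σ) :
    ∃ h, HasLinRes h 1 (unitSubmodule (Ideal.span (X '' (S : Set σ) : Set (MvPolynomial σ k)))) := by
  classical
  induction S using Finset.induction_on with
  | empty => exact ⟨0, by simpa using hasLinRes_bot 1⟩
  | insert s S hs ih =>
    obtain ⟨h, hh⟩ := ih
    -- As `s ∉ S`, the variable `x_s` is a nonzerodivisor modulo the ideal of `S`. The colon ideal
    -- is thus that ideal itself, and `hh` serves twice.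
    obtain ⟨h', hh'⟩ := hh.sup_span_singleton (isHomogeneous_X k s) (fun r => by
      simp only [mem_ideal_span_X_image, Finset.mem_coe]
      constructor
      · intro hr m hm
        rw [support_mul_X, Finset.mem_map] at hm
        obtain ⟨m, hm, rfl⟩ := hm
        obtain ⟨i, hi, hmi⟩ := hr m hm
        exact ⟨i, hi, by simp [hmi]⟩
      · intro hr m hm
        obtain ⟨i, hi, hmi⟩ := hr (m + single s 1) (by
          rw [support_mul_X, Finset.mem_map]
          exact ⟨m, hm, rfl⟩)
        have : s ≠ i := fun e => hs (e ▸ hi)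
        exact ⟨i, hi, by simpa [single_apply, this] using hmi⟩) hh
    refine ⟨h', ?_⟩
    rwa [Finset.coe_insert, Set.image_insert_eq, Ideal.span_insert, sup_comm]

end Graded

/-! ### From linear resolutions to minimal graded free resolutions. -/

section Conversion

variable {σ k : Type*} [Field k]

/-- A linear free resolution of the submodule `N` of a free module, generated in degree `d`. -/
structure LinearChain {G : Type} (d : ℕ)
    (N : Submodule (MvPolynomial σ k) (G →₀ MvPolynomial σ k)) where
  /-- the bases -/
  gen : ℕ → Type
  finite_gen : ∀ i, Finite (gen i)
  /-- the columns of the differentials -/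
  diff : ∀ i, gen (i + 1) → gen i →₀ MvPolynomial σ k
  /-- the columns of the augmentation -/
  aug : gen 0 → G →₀ MvPolynomial σ k
  diff_homogeneous : ∀ i e g, (diff i e g).IsHomogeneous 1
  aug_homogeneous : ∀ e g, (aug e g).IsHomogeneous d
  range_aug : LinearMap.range (linearCombination (MvPolynomial σ k) aug) = N
  range_diff_zero : LinearMap.range (linearCombination (MvPolynomial σ k) (diff 0)) =
    LinearMap.ker (linearCombination (MvPolynomial σ k) aug)
  range_diff_succ : ∀ i, LinearMap.range (linearCombination (MvPolynomial σ k) (diff (i + 1))) =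
    LinearMap.ker (linearCombination (MvPolynomial σ k) (diff i))
  finite_length : ∃ h, ∀ i, h < i → IsEmpty (gen i)

/-- The chain of length zero. -/
noncomputable def LinearChain.nil {G : Type} (d : ℕ) :
    LinearChain d (⊥ : Submodule (MvPolynomial σ k) (G →₀ MvPolynomial σ k)) where
  gen _ := Empty
  finite_gen _ := inferInstance
  diff _ e := e.elim
  aug e := e.elim
  diff_homogeneous _ e := e.elim
  aug_homogeneous e := e.elim
  range_aug := by rw [range_linearCombination]; simp
  range_diff_zero := Subsingleton.elim _ _
  range_diff_succ _ := Subsingleton.elim _ _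
  finite_length := ⟨0, fun _ _ => inferInstanceAs (IsEmpty Empty)⟩

/-- Prolong a chain resolving the syzygies of `v` by `v`. -/
def LinearChain.cons {G G' : Type} [Finite G'] {d : ℕ} {v : G' → G →₀ MvPolynomial σ k}
    (hv : ∀ e g, (v e g).IsHomogeneous d)
    (c : LinearChain 1 (LinearMap.ker (linearCombination (MvPolynomial σ k) v))) :
    LinearChain d (LinearMap.range (linearCombination (MvPolynomial σ k) v)) where
  gen
    | 0 => G'
    | i + 1 => c.gen i
  finite_gen
    | 0 => inferInstance
    | i + 1 => c.finite_gen i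
  diff
    | 0 => c.aug
    | i + 1 => c.diff i
  aug := v
  diff_homogeneous
    | 0 => c.aug_homogeneous
    | i + 1 => c.diff_homogeneous i
  aug_homogeneous := hv
  range_aug := rfl
  range_diff_zero := c.range_aug
  range_diff_succ
    | 0 => c.range_diff_zero
    | i + 1 => c.range_diff_succ i
  finite_length := by
    obtain ⟨h, hh⟩ := c.finite_length
    refine ⟨h + 1, fun i hi => ?_⟩
    cases i with
    | zero => omega
    | succ i => exact hh i (by omega)

theorem HasLinRes.nonempty_linearChain {h : ℕ} : ∀ {G : Type} {d : ℕ}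
    {N : Submodule (MvPolynomial σ k) (G →₀ MvPolynomial σ k)},
    HasLinRes h d N → Nonempty (LinearChain d N) := by
  induction h with
  | zero =>
    intro G d N hN
    obtain rfl : N = ⊥ := hN
    exact ⟨.nil d⟩
  | succ h ih =>
    rintro G d N ⟨G', _, v, hv, rfl, hk⟩
    obtain ⟨c⟩ := ih hk
    exact ⟨.cons hv c⟩

/-- The minimal graded free resolution of an ideal given by a linear chain. -/
noncomputable def LinearChain.toResolution {I : Ideal (MvPolynomial σ k)} {d : ℕ}
    (c : LinearChain d (unitSubmodule I)) : MinimalGradedFreeResolution I where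
  gen := c.gen
  finite_gen := c.finite_gen
  deg i _ := i + d
  d i := linearCombination (MvPolynomial σ k) (c.diff i)
  ε := (Finsupp.lapply ()).comp (linearCombination (MvPolynomial σ k) c.aug)
  d_homogeneous i e f m hm := by
    rw [linearCombination_single, one_smul] at hm
    have := c.diff_homogeneous i e f hm
    change Finsupp.weight (fun _ => 1) m = 1 at this
    rw [← Finsupp.degree_eq_weight_one] at this
    change m.degree + (i + d) = i + 1 + d
    omega
  ε_homogeneous e := by
    simpa using c.aug_homogeneous e ()
  range_ε := by
    rw [LinearMap.range_comp, c.range_aug]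
    ext p
    constructor
    · rintro ⟨x, hx, rfl⟩
      exact hx
    · intro hp
      exact ⟨single () p, by simpa using hp, by simp⟩
  exact_zero := by
    rw [LinearMap.exact_iff, c.range_diff_zero]
    ext x
    simp only [LinearMap.mem_ker, LinearMap.comp_apply, Finsupp.lapply_apply]
    constructor
    · intro hx
      ext1
      exact hx
    · intro hx
      rw [hx, Finsupp.zero_apply]
  exact_succ i := by
    rw [LinearMap.exact_iff, c.range_diff_succ]
  finite_length := c.finite_length
  -- The entries are forms of degree `1`, so their coefficient at the monomial `1` vanishes.
  minimal i e f := by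
    rw [linearCombination_single, one_smul, constantCoeff_eq]
    exact (c.diff_homogeneous i e f).coeff_eq_zero (by simp)

theorem HasLinRes.exists_resolution {I : Ideal (MvPolynomial σ k)} {d h : ℕ}
    (hI : HasLinRes h d (unitSubmodule I)) :
    ∃ F : MinimalGradedFreeResolution I, ∀ i j, j ≠ i + d → F.betti i j = 0 := by
  obtain ⟨c⟩ := hI.nonempty_linearChain
  refine ⟨c.toResolution, fun i j hj => ?_⟩
  have : IsEmpty {e : c.toResolution.gen i // c.toResolution.deg i e = j} :=
    ⟨fun e => hj e.2.symm⟩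
  exact Nat.card_of_isEmpty

end Conversion

/-! ### Linear quotients of monomial ideals. -/

section Quotients

variable {σ k : Type*} [Field k]

/-- A finite set of monomials of degree `d`, ordered by `f` such that, for `v` and `u` in the set
with `f v < f u`, some `w` with `f v < f w` arises from `v` by replacing a variable by a variable
that is more frequent in `u`, has linear quotients and generates an ideal with a linear
resolution. -/
theorem exists_hasLinRes_of_exchange [Finite σ] {ι : Type*} [LinearOrder ι] {f : (σ →₀ ℕ) → ι}
    (hf : Function.Injective f) {d : ℕ} (T : Finset (σ →₀ ℕ)) (hd : ∀ v ∈ T, v.degree = d)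
    (hT : ∀ v ∈ T, ∀ u ∈ T, f v < f u →
      ∃ j, v j < u j ∧ ∃ w ∈ T, f v < f w ∧ w ≤ v + single j 1) :
    ∃ h, HasLinRes h d (unitSubmodule
      (Ideal.span ((fun m => monomial m (1 : k)) '' (T : Set (σ →₀ ℕ))))) := by
  classical
  -- The `f`-smallest monomial `v` is adjoined last, so `s` consists of larger ones and an exchange
  -- partner `w` with a larger key is never `v`.
  induction T using Finset.induction_on_min_value f with
  | empty => exact ⟨0, by simpa using hasLinRes_bot d⟩
  | insert v s hv hmin ih =>
    obtain ⟨h, hh⟩ := ih (fun v hv => hd v (Finset.mem_insert_of_mem hv)) (by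
      intro x hx u hu hxu
      obtain ⟨j, hj, w, hw, hxw, hwj⟩ :=
        hT x (Finset.mem_insert_of_mem hx) u (Finset.mem_insert_of_mem hu) hxu
      refine ⟨j, hj, w, (Finset.mem_insert.1 hw).resolve_left ?_, hxw, hwj⟩
      rintro rfl
      exact (hmin x hx).not_gt hxw)
    -- These variables generate the colon ideal of `s` by `v`: if `u ∈ s` divides `m + v`, the
    -- exchanged index has `v j < u j ≤ m j + v j`, so `x_j` divides `m`.
    obtain ⟨h₁, hh₁⟩ := exists_hasLinRes_span_X (k := k)
      (Set.toFinite {j | ∃ w ∈ s, w ≤ v + single j 1}).toFinset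
    have hvd : (monomial v (1 : k)).IsHomogeneous d :=
      isHomogeneous_monomial _ (hd v (Finset.mem_insert_self _ _))
    obtain ⟨h₂, hh₂⟩ := hh.sup_span_singleton hvd (fun r => by
      simp only [mem_ideal_span_X_image, mem_ideal_span_monomial_image, Set.Finite.coe_toFinset,
        Set.mem_ofPred_eq, Finset.mem_coe]
      constructor
      · intro hr m hm
        rw [MvPolynomial.mem_support_iff, coeff_mul_monomial'] at hm
        split_ifs at hm with hvm
        · obtain ⟨j, ⟨w, hw, hwj⟩, hj⟩ := hr (m - v) (by
            rw [MvPolynomial.mem_support_iff]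
            simpa using hm)
          refine ⟨w, hw, hwj.trans ?_⟩
          calc v + single j 1 ≤ v + (m - v) := by
                gcongr
                rw [single_le_iff]
                exact Nat.one_le_iff_ne_zero.2 hj
            _ = m := add_tsub_cancel_of_le hvm
        · exact absurd rfl hm
      · intro hr m hm
        obtain ⟨u, hu, hum⟩ := hr (m + v) (by
          rw [MvPolynomial.mem_support_iff, coeff_mul_monomial, mul_one]
          exact MvPolynomial.mem_support_iff.1 hm)
        have hvu : f v < f u := lt_of_le_of_ne (hmin u hu) fun e => hv (hf e ▸ hu)
        obtain ⟨j, hj, w, hw, hvw, hwj⟩ :=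
          hT v (Finset.mem_insert_self _ _) u (Finset.mem_insert_of_mem hu) hvu
        refine ⟨j, ⟨w, (Finset.mem_insert.1 hw).resolve_left ?_, hwj⟩, ?_⟩
        · rintro rfl
          exact lt_irrefl _ hvw
        · have := hum j
          rw [Finsupp.add_apply] at this
          omega) hh₁
    refine ⟨h₂, ?_⟩
    rwa [Finset.coe_insert, Set.image_insert_eq, Ideal.span_insert, sup_comm]

end Quotients

/-! ### Block degrees and the exchange property. -/

section Combinatorics

/-- The degree of a monomial in the variables from `S`. -/
def partDegree {σ : Type*} (S : Finset σ) (m : σ →₀ ℕ) : ℕ := ∑ j ∈ S, m j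

section

variable {σ : Type*}

theorem partDegree_mono (S : Finset σ) {m m' : σ →₀ ℕ} (h : m ≤ m') :
    partDegree S m ≤ partDegree S m' :=
  Finset.sum_le_sum fun j _ => h j

theorem partDegree_add (S : Finset σ) (m m' : σ →₀ ℕ) :
    partDegree S (m + m') = partDegree S m + partDegree S m' := by
  simp [partDegree, Finset.sum_add_distrib]

theorem partDegree_single [DecidableEq σ] (S : Finset σ) (j : σ) :
    partDegree S (single j 1) = if j ∈ S then 1 else 0 := by
  simp [partDegree, single_apply]

theorem exists_lt_of_partDegree_lt {S : Finset σ} {v u : σ →₀ ℕ}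
    (h : partDegree S v < partDegree S u) : ∃ j ∈ S, v j < u j :=
  Finset.exists_lt_of_sum_lt h

theorem exists_pos_of_partDegree_pos {S : Finset σ} {v : σ →₀ ℕ} (h : 0 < partDegree S v) :
    ∃ j ∈ S, 0 < v j := by
  by_contra! hc
  exact h.ne' (Finset.sum_eq_zero fun j hj => Nat.le_zero.1 (hc j hj))

theorem partDegree_inter_add_sdiff [DecidableEq σ] (J K : Finset σ) (m : σ →₀ ℕ) :
    partDegree (J ∩ K) m + partDegree (J \ K) m = partDegree J m :=
  Finset.sum_inter_add_sum_sdiff J K m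

end

section

variable {σ : Type*} [LinearOrder σ]

/-- Monomials are compared by their degrees in `J ∩ K`, in the symmetric difference of `J` and
`K`, in `J \ K`, and finally lexicographically. -/
def orderKey (J K : Finset σ) (m : σ →₀ ℕ) : ℕ ×ₗ ℕ ×ₗ ℕ ×ₗ Lex (σ →₀ ℕ) :=
  toLex (partDegree (J ∩ K) m, toLex (partDegree (J \ K) m + partDegree (K \ J) m,
    toLex (partDegree (J \ K) m, toLex m)))

theorem orderKey_injective (J K : Finset σ) : Function.Injective (orderKey J K) := by
  intro m m' h
  exact toLex.injective (congrArg (fun x => (ofLex (ofLex (ofLex x).2).2).2) h)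

theorem orderKey_lt_iff {J K : Finset σ} {v u : σ →₀ ℕ} :
    orderKey J K v < orderKey J K u ↔ partDegree (J ∩ K) v < partDegree (J ∩ K) u ∨
      partDegree (J ∩ K) v = partDegree (J ∩ K) u ∧
      (partDegree (J \ K) v + partDegree (K \ J) v < partDegree (J \ K) u + partDegree (K \ J) u ∨
      partDegree (J \ K) v + partDegree (K \ J) v = partDegree (J \ K) u + partDegree (K \ J) u ∧
      (partDegree (J \ K) v < partDegree (J \ K) u ∨
      partDegree (J \ K) v = partDegree (J \ K) u ∧ toLex v < toLex u)) := by
  simp only [orderKey, Prod.Lex.toLex_lt_toLex]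

/-- Lexicographic comparison yields an exchange within one block. -/
theorem exists_exchange_of_lex_lt {v u : σ →₀ ℕ} (h : toLex v < toLex u) {S : Finset σ → Prop}
    (hS : ∀ j, ∃ s, S s ∧ j ∈ s) (hvu : ∀ s, S s → partDegree s v = partDegree s u) :
    ∃ j i s, S s ∧ j ∈ s ∧ i ∈ s ∧ j < i ∧ v j < u j ∧ 0 < v i := by
  obtain ⟨j, hj, hlt⟩ := Finsupp.Lex.lt_iff.1 h
  obtain ⟨s, hs, hjs⟩ := hS j
  by_contra! hc
  refine (hvu s hs).not_lt (Finset.sum_lt_sum (fun i hi => ?_) ⟨j, hjs, hlt⟩)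
  rcases lt_trichotomy i j with hij | rfl | hij
  · exact (hj i hij).le
  · exact hlt.le
  · have := hc j i s hs hjs hi hij hlt
    omega

variable [Fintype σ]

theorem degree_eq_partDegree (J K : Finset σ) (m : σ →₀ ℕ) :
    m.degree = partDegree (J ∩ K) m + partDegree (J \ K) m + partDegree (K \ J) m +
      partDegree (Finset.univ \ (J ∪ K)) m := by
  have h₁ : m.degree = partDegree Finset.univ m := by
    rw [Finsupp.degree_eq_sum, partDegree]
  have h₂ := partDegree_inter_add_sdiff Finset.univ (J ∪ K) m
  have h₃ := partDegree_inter_add_sdiff (J ∪ K) J m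
  have e₁ : (J ∪ K) ∩ J = J := by grind
  have e₂ : (J ∪ K) \ J = K \ J := by grind
  have h₄ := partDegree_inter_add_sdiff J K m
  rw [e₁, e₂] at h₃
  rw [Finset.univ_inter] at h₂
  omega

/-- A factor `x_i` of `v` is replaced by `x_j`. The first entry of `orderKey` in which `v` and `u`
differ decides the blocks of `i` and `j`, and the order of the entries ensures that neither bound
`a` nor `b` is violated. -/
theorem exists_exchange {J K : Finset σ} {a b d : ℕ} {v u : σ →₀ ℕ}
    (hv : v.degree = d ∧ a ≤ partDegree J v ∧ b ≤ partDegree K v)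
    (hu : u.degree = d ∧ a ≤ partDegree J u ∧ b ≤ partDegree K u)
    (h : orderKey J K v < orderKey J K u) :
    ∃ j, v j < u j ∧ ∃ w : σ →₀ ℕ, (w.degree = d ∧ a ≤ partDegree J w ∧ b ≤ partDegree K w) ∧
      orderKey J K v < orderKey J K w ∧ w ≤ v + single j 1 := by
  suffices H : ∃ j i, v j < u j ∧ 0 < v i ∧ ∀ w : σ →₀ ℕ, w + single i 1 = v + single j 1 →
      (a ≤ partDegree J w ∧ b ≤ partDegree K w) ∧ orderKey J K v < orderKey J K w by
    obtain ⟨j, i, hj, hi, H⟩ := H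
    have hle : single i 1 ≤ v + single j 1 :=
      (Finsupp.single_le_iff.2 hi).trans le_self_add
    have hw := tsub_add_cancel_of_le hle
    refine ⟨j, hj, v + single j 1 - single i 1, ⟨?_, (H _ hw).1⟩, (H _ hw).2, tsub_le_self⟩
    have := congrArg Finsupp.degree hw
    simp only [map_add, degree_single] at this
    omega
  have key : ∀ {i j : σ} {w : σ →₀ ℕ} (_ : w + single i 1 = v + single j 1) (S : Finset σ),
      partDegree S w + (if i ∈ S then 1 else 0) = partDegree S v + if j ∈ S then 1 else 0 := by
    intro i j w hw S
    rw [← partDegree_single, ← partDegree_single, ← partDegree_add, ← partDegree_add, hw]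
  have dv := degree_eq_partDegree J K v
  have du := degree_eq_partDegree J K u
  have Jv := partDegree_inter_add_sdiff J K v
  have Kv := partDegree_inter_add_sdiff K J v
  have Ju := partDegree_inter_add_sdiff J K u
  have Ku := partDegree_inter_add_sdiff K J u
  rw [Finset.inter_comm K J] at Kv Ku
  simp only [orderKey_lt_iff] at h ⊢
  rcases h with h | ⟨h₁, h | ⟨h₂, h | ⟨h₃, h⟩⟩⟩
  · obtain ⟨j, hj, hlt⟩ := exists_lt_of_partDegree_lt h
    -- If `v` involved only variables of `J ∩ K`, its degree there would be `d`, which `u` cannot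
    -- exceed. Since `j` counts for both `J` and `K`, any such `i` may be given up.
    obtain ⟨i, hi, hpos⟩ : ∃ i, i ∉ J ∩ K ∧ 0 < v i := by
      by_contra! hc
      have z : ∀ S : Finset σ, Disjoint S (J ∩ K) → partDegree S v = 0 := fun S hS =>
        Finset.sum_eq_zero fun i hi => Nat.le_zero.1 (hc i (Finset.disjoint_left.1 hS hi))
      have z₁ := z (J \ K) (by rw [Finset.disjoint_left]; grind)
      have z₂ := z (K \ J) (by rw [Finset.disjoint_left]; grind)
      have z₃ := z (Finset.univ \ (J ∪ K)) (by rw [Finset.disjoint_left]; grind)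
      omega
    refine ⟨j, i, hlt, hpos, fun w hw => ?_⟩
    have w₁ := key hw (J ∩ K)
    have w₂ := key hw J
    have w₃ := key hw K
    have := Finset.mem_inter.1 hj
    rw [if_neg hi, if_pos hj] at w₁
    rw [if_pos this.1] at w₂
    rw [if_pos this.2] at w₃
    refine ⟨⟨?_, ?_⟩, Or.inl (by omega)⟩
    · split_ifs at w₂ <;> omega
    · split_ifs at w₃ <;> omega
  -- Total degrees agree, so `v` has the larger degree outside `J ∪ K`; removing a variable there
  -- costs nothing in `J` or `K`.
  · obtain ⟨i, hi, hpos⟩ := exists_pos_of_partDegree_pos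
      (S := Finset.univ \ (J ∪ K)) (v := v) (by omega)
    obtain ⟨j, hj, hlt⟩ : ∃ j, (j ∈ J \ K ∨ j ∈ K \ J) ∧ v j < u j := by
      by_cases hc : partDegree (J \ K) v < partDegree (J \ K) u
      · obtain ⟨j, hj, hlt⟩ := exists_lt_of_partDegree_lt hc
        exact ⟨j, .inl hj, hlt⟩
      · obtain ⟨j, hj, hlt⟩ := exists_lt_of_partDegree_lt (S := K \ J) (v := v) (u := u) (by omega)
        exact ⟨j, .inr hj, hlt⟩
    refine ⟨j, i, hlt, hpos, fun w hw => ?_⟩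
    have w₁ := key hw (J ∩ K)
    have w₂ := key hw J
    have w₃ := key hw K
    have w₄ := key hw (J \ K)
    have w₅ := key hw (K \ J)
    simp only [Finset.mem_sdiff, Finset.mem_univ, Finset.mem_union, true_and, not_or,
      Finset.mem_inter] at hi hj w₁ w₄ w₅
    rcases hj with ⟨hjJ, hjK⟩ | ⟨hjK, hjJ⟩ <;>
    · simp only [hi.1, hi.2, hjJ, hjK, and_self, and_true, and_false, not_true, not_false_iff,
        if_true, if_false, add_zero] at w₁ w₂ w₃ w₄ w₅
      refine ⟨⟨by omega, by omega⟩, Or.inr ⟨by omega, Or.inl (by omega)⟩⟩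
  · obtain ⟨j, hj, hlt⟩ := exists_lt_of_partDegree_lt h
    -- Here `v` exceeds `u` in `K \ J`, so its degree in `K` is greater than that of `u`, hence
    -- greater than `b`, and may drop by one.
    obtain ⟨i, hi, hpos⟩ := exists_pos_of_partDegree_pos (S := K \ J) (v := v) (by omega)
    refine ⟨j, i, hlt, hpos, fun w hw => ?_⟩
    have w₁ := key hw (J ∩ K)
    have w₂ := key hw J
    have w₃ := key hw K
    have w₄ := key hw (J \ K)
    have w₅ := key hw (K \ J)
    simp only [Finset.mem_sdiff, Finset.mem_inter] at hi hj w₁ w₄ w₅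
    simp only [hi.1, hi.2, hj.1, hj.2, and_self, and_true, and_false, not_true, not_false_iff,
        if_true, if_false, add_zero] at w₁ w₂ w₃ w₄ w₅
    exact ⟨⟨by omega, by omega⟩,
      Or.inr ⟨by omega, Or.inr ⟨by omega, Or.inl (by omega)⟩⟩⟩
  -- All four block degrees agree. An exchange inside one block preserves them, and raising the
  -- exponent at `j < i` increases the lexicographic key.
  · obtain ⟨j, i, s, hs, hj, hi, hji, hlt, hpos⟩ := exists_exchange_of_lex_lt h
      (S := fun s => s ∈ [J ∩ K, J \ K, K \ J, Finset.univ \ (J ∪ K)])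
      (fun j => by
        by_cases h₁ : j ∈ J <;> by_cases h₂ : j ∈ K <;> simp [h₁, h₂])
      (fun s hs => by
        simp only [List.mem_cons, List.not_mem_nil, or_false] at hs
        rcases hs with rfl | rfl | rfl | rfl <;> omega)
    have hJK : (i ∈ J ↔ j ∈ J) ∧ (i ∈ K ↔ j ∈ K) := by
      simp only [List.mem_cons, List.not_mem_nil, or_false] at hs
      rcases hs with rfl | rfl | rfl | rfl <;> simp at hi hj <;> tauto
    refine ⟨j, i, hlt, hpos, fun w hw => ?_⟩
    have w₁ := key hw (J ∩ K)
    have w₂ := key hw J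
    have w₃ := key hw K
    have w₄ := key hw (J \ K)
    have w₅ := key hw (K \ J)
    simp only [Finset.mem_sdiff, Finset.mem_inter, hJK, add_left_inj] at w₁ w₂ w₃ w₄ w₅
    refine ⟨⟨by omega, by omega⟩,
      Or.inr ⟨by omega, Or.inr ⟨by omega, Or.inr ⟨by omega, ?_⟩⟩⟩⟩
    refine Finsupp.Lex.lt_iff.2 ⟨j, fun l hl => ?_, ?_⟩
    · have := DFunLike.congr_fun hw l
      simpa [single_apply, hl.ne', (hl.trans hji).ne'] using this.symm
    · have := DFunLike.congr_fun hw j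
      simp only [Finsupp.add_apply, single_apply, if_neg hji.ne', if_true] at this
      simp only [ofLex_toLex]
      omega

end

end Combinatorics

/-! ### Powers of variable ideals and components of monomial ideals. -/

section Main

variable {σ k : Type*} [Field k]

/-- Powers of ideals generated by variables are described by partial degrees. -/
theorem mem_veroneseIdeal_pow {S : Finset σ} {a : ℕ} {f : MvPolynomial σ k} :
    f ∈ veroneseIdeal k (S : Set σ) ^ a ↔ ∀ m ∈ f.support, a ≤ partDegree S m := by
  classical
  have hmono : ∀ (a : ℕ) (m : σ →₀ ℕ), a ≤ partDegree S m →
      monomial m (1 : k) ∈ veroneseIdeal k (S : Set σ) ^ a := by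
    intro a
    induction a with
    | zero => simp
    | succ a ih =>
      intro m hm
      obtain ⟨j, hj, hpos⟩ := exists_pos_of_partDegree_pos (S := S) (v := m) (by omega)
      have hle : single j 1 ≤ m := Finsupp.single_le_iff.2 hpos
      have e := tsub_add_cancel_of_le hle
      have hd := congrArg (partDegree S) e
      rw [partDegree_add, partDegree_single, if_pos hj] at hd
      have : monomial m (1 : k) = monomial (m - single j 1) 1 * X j := by
        rw [X, monomial_mul, e, one_mul]
      rw [this, pow_succ]
      exact Ideal.mul_mem_mul (ih _ (by omega)) (Ideal.subset_span ⟨j, hj, rfl⟩)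
  constructor
  · suffices H : veroneseIdeal k (S : Set σ) ^ a ≤
        Ideal.span ((fun m => monomial m (1 : k)) '' {m | a ≤ partDegree S m}) by
      intro hf m hm
      obtain ⟨m', hm', hle⟩ := mem_ideal_span_monomial_image.1 (H hf) m hm
      exact le_trans hm' (partDegree_mono S hle)
    clear f
    induction a with
    | zero =>
      intro f _
      exact mem_ideal_span_monomial_image.2 fun m _ => ⟨m, Nat.zero_le _, le_rfl⟩
    | succ a ih =>
      rw [pow_succ]
      refine (Ideal.mul_mono_left ih).trans ?_
      rw [veroneseIdeal, Ideal.span_mul_span', Ideal.span_le]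
      rintro _ ⟨_, ⟨m, hm, rfl⟩, _, ⟨j, hj, rfl⟩, rfl⟩
      refine Ideal.subset_span ⟨m + single j 1, ?_, ?_⟩
      · change a + 1 ≤ partDegree S (m + single j 1)
        rw [partDegree_add, partDegree_single, if_pos (Finset.mem_coe.1 hj)]
        exact Nat.add_le_add_right hm 1
      · simp [X, monomial_mul]
  · intro hf
    rw [f.as_sum]
    refine Ideal.sum_mem _ fun m hm => ?_
    rw [← mul_one (coeff m f), ← C_mul_monomial]
    exact Ideal.mul_mem_left _ _ (hmono a m (hf m hm))

theorem component_le (I : Ideal (MvPolynomial σ k)) (d : ℕ) : component I d ≤ I :=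
  Ideal.span_le.2 fun _ hf => hf.1

theorem component_component (I : Ideal (MvPolynomial σ k)) (d : ℕ) :
    component (component I d) d = component I d :=
  le_antisymm (component_le _ _)
    (Ideal.span_mono fun _ hf => ⟨Ideal.subset_span hf, hf.2⟩)

/-- The component of a monomial ideal is generated by its monomials of the given degree. -/
theorem component_eq_span_monomial {I : Ideal (MvPolynomial σ k)} {M : Set (σ →₀ ℕ)}
    (hI : ∀ f, f ∈ I ↔ ∀ m ∈ f.support, m ∈ M) (d : ℕ) :
    component I d = Ideal.span ((fun m => monomial m (1 : k)) '' {m | m.degree = d ∧ m ∈ M}) := by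
  apply le_antisymm
  · refine Ideal.span_le.2 fun f hf => mem_ideal_span_monomial_image.2 fun m hm =>
      ⟨m, ⟨?_, (hI f).1 hf.1 m hm⟩, le_rfl⟩
    have := hf.2 (MvPolynomial.mem_support_iff.1 hm)
    rw [Finsupp.degree_eq_weight_one]
    exact this
  · rw [Ideal.span_le]
    rintro _ ⟨m, ⟨hd, hm⟩, rfl⟩
    refine Ideal.subset_span ⟨(hI _).2 fun m' hm' => ?_, isHomogeneous_monomial _ hd⟩
    rwa [Finset.mem_singleton.1 (support_monomial_subset hm')]

theorem isHomogeneous_of_mem_iff {I : Ideal (MvPolynomial σ k)} {M : Set (σ →₀ ℕ)}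
    (hI : ∀ f, f ∈ I ↔ ∀ m ∈ f.support, m ∈ M) :
    letI : GradedAlgebra (homogeneousSubmodule σ k) := MvPolynomial.gradedAlgebra
    I.IsHomogeneous (homogeneousSubmodule σ k) := by
  intro i f hf
  rw [hI] at hf ⊢
  intro m hm
  refine hf m ?_
  rw [MvPolynomial.mem_support_iff] at hm ⊢
  intro h0
  apply hm
  rw [← DirectSum.Decomposition.decompose'_eq, decomposition.decompose'_apply, coeff_homogeneousComponent, h0, ite_self]

end Main

end CWL

theorem corollary3p2 (k : Type*) [Field k] (n : ℕ) (J K : Set (Fin n)) (a b : ℕ)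
    (ha : 0 < a) (hb : 0 < b) :
    CWL.IsComponentwiseLinear (CWL.veroneseIdeal k J ^ a ⊓ CWL.veroneseIdeal k K ^ b) := by
  classical
  lift J to Finset (Fin n) using J.toFinite
  lift K to Finset (Fin n) using K.toFinite
  have hI : ∀ f, f ∈ CWL.veroneseIdeal k (J : Set (Fin n)) ^ a ⊓ CWL.veroneseIdeal k K ^ b ↔
      ∀ m ∈ f.support, m ∈ {m | a ≤ CWL.partDegree J m ∧ b ≤ CWL.partDegree K m} := by
    intro f
    rw [Submodule.mem_inf, CWL.mem_veroneseIdeal_pow, CWL.mem_veroneseIdeal_pow, ← forall₂_and]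
    rfl
  refine ⟨CWL.isHomogeneous_of_mem_iff hI, fun d => ⟨CWL.component_component _ _, ?_⟩⟩
  have hfin : {m : Fin n →₀ ℕ | m.degree = d ∧
      m ∈ {m | a ≤ CWL.partDegree J m ∧ b ≤ CWL.partDegree K m}}.Finite :=
    (Finsupp.finite_of_degree_le d).subset fun m hm => hm.1.le
  obtain ⟨h, hh⟩ := CWL.exists_hasLinRes_of_exchange (k := k) (CWL.orderKey_injective J K)
    (d := d) hfin.toFinset (fun v hv => ((Set.Finite.mem_toFinset _).1 hv).1) (by
      intro v hv u hu hvu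
      simp only [Set.Finite.mem_toFinset] at hv hu ⊢
      exact CWL.exists_exchange hv hu hvu)
  rw [Set.Finite.coe_toFinset, ← CWL.component_eq_span_monomial hI] at hh
  exact hh.exists_resolution
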